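/- Let $\mathcal X=\mathcal X_1\times\dots\times\mathcal X_n$ be a product of finite sets and let $\pi$ be a probability distribution on $\mathcal X$. For a site $i\in[n]$ let $P_i$ be the Markov kernel on the support of $\pi$ that resamples the $i$-th coordinate from the conditional distribution of $\pi$ given all the other coordinates. Glauber dynamics is $P_{\mathsf{GD}}=\frac1n\sum_{i=1}^nP_i$. For a permutation $\sigma$ of $[n]$ (a scan order), the systematic scan is $P_\sigma=P_{\sigma(n)}\cdots P_{\sigma(1)}$, so that one step of it is a full sweep of $n$ site updates. For a Markov kernel $P$ on the support of $\pi$ put $d_P(t)=\max_{x:\pi(x)>0} d_{\mathrm{TV}}(P^t(x,\cdot),\pi)$, where $d_{\mathrm{TV}}(\mu,\nu)=\frac12\sum_x|\mu(x)-\nu(x)|$, and $t_{\mathrm{mix}}(\varepsilon)=\min\{t\ge 0: d_P(t)\le\varepsilon\}$; write $t^{\mathsf{GD}}_{\mathrm{mix}}(\varepsilon)$ and $t^{\mathsf{SS}(\sigma)}_{\mathrm{mix}}(\varepsilon)$ for $P=P_{\mathsf{GD}}$ and $P=P_\sigma$. Let $\pi_{\min}=\min_{x:\pi(x)>0}\pi(x)$.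 The hardcore model on a graph $G$ with vertex set $[n]$ and fugacity $\lambda$ is the distribution on $\{0,1\}^n$ that gives the indicator vector of a set $I\subseteq[n]$ a probability proportional to $\lambda^{|I|}$ if $I$ is independent in $G$, and $0$ otherwise. (For the complete graph $K_n$ and $\lambda=1$ it is uniform on $\{\mathbf 0,\mathbf e_1,\dots,\mathbf e_n\}$.) **Theorem.** There is an absolute constant $c>0$ such that the following hold for every $n\ge1$. 1. For the hardcore model on $K_n$ with fugacity $1$ and every permutation $\sigma$ of $[n]$, both mixing times exist (are finite) and $$t^{\mathsf{SS}(\sigma)}_{\mathrm{mix}}(1/4)\ \ge\ c\,n\,t^{\mathsf{GD}}_{\mathrm{mix}}(1/4).$$ 2. Consequently the general upper bound $t^{\mathsf{SS}(\sigma)}_{\mathrm{mix}}(\varepsilon)\le C\,n\,t^{\mathsf{GD}}_{\mathrm{mix}}(1/4)\log\frac1{\varepsilon\pi_{\min}}$ is tight up to the factor $\log(1/\pi_{\min})$, in the following sense. Let $\Phi:\mathbb R\to\mathbb R$ be any function such that $$t^{\mathsf{SS}(\sigma)}_{\mathrm{mix}}(1/4)\ \le\ \Phi(\pi_{\min})\;t^{\mathsf{GD}}_{\mathrm{mix}}(1/4)$$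 for all probability distributions $\pi$ on products of $n$ finite sets and all permutations $\sigma$ of $[n]$ for which both mixing times exist. Then $\Phi\left(\frac1{n+1}\right)\ge c\,n$, where $\frac1{n+1}$ is the value of $\pi_{\min}$ for the hardcore model on $K_n$ with fugacity $1$. -/

import Mathlib

noncomputable section

namespace Gibbs

/-- The states that have positive probability under `π`: the state space of the Gibbs samplers. -/
abbrev Supp {Ω : Type} (π : Ω → ℝ) : Type := {x : Ω // π x ≠ 0}

open Classical in
/-- The single-site kernel `P_i`, on the support of a distribution `π` on `X_1 × ... × X_n`:
the value at site `i` is resampled from the conditional distribution of `π` given the values at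
all other sites. -/
def siteKernel {n : ℕ} {X : Fin n → Type} [∀ i, Fintype (X i)] (π : (∀ i, X i) → ℝ)
    (i : Fin n) : Matrix (Supp π) (Supp π) ℝ :=
  Matrix.of fun x y =>
    if ∀ j, j ≠ i → y.1 j = x.1 j then
      π y.1 / ∑ z : X i, π (Function.update x.1 i z)
    else 0

/-- Glauber dynamics: `P_GD = (1/n) ∑ i, P_i`. -/
def glauber {n : ℕ} {X : Fin n → Type} [∀ i, Fintype (X i)] (π : (∀ i, X i) → ℝ) :
    Matrix (Supp π) (Supp π) ℝ :=
  (1 / (n : ℝ)) • ∑ i : Fin n, siteKernel π i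

open Classical in
/-- One full sweep of the systematic scan: `P_σ = P_{σ(n)} ⋯ P_{σ(1)}`. -/
def systematicScan {n : ℕ} {X : Fin n → Type} [∀ i, Fintype (X i)] (π : (∀ i, X i) → ℝ)
    (σ : Equiv.Perm (Fin n)) : Matrix (Supp π) (Supp π) ℝ :=
  ((List.ofFn fun i : Fin n => siteKernel π (σ i)).reverse).prod

/-- Total variation distance on a finite set. -/
def tvDist {Ω : Type} [Fintype Ω] (μ ν : Ω → ℝ) : ℝ :=
  (1 / 2) * ∑ x, |μ x - ν x|

open Classical in
/-- Distance to stationarity after `t` steps: `d_P(t) = max_x d_TV(P^t(x, ·), π)`, the maximum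
over the starting states in the support of `π`. -/
def distToStationarity {Ω : Type} [Fintype Ω] (π : Ω → ℝ)
    (P : Matrix (Supp π) (Supp π) ℝ) (t : ℕ) : ℝ :=
  ⨆ x : Supp π, tvDist (fun y : Supp π => (P ^ t) x y) (fun y : Supp π => π y.1)

/-- `t` is the `ε`-mixing time `min {t : d_P(t) ≤ ε}` of `P`; in particular, the minimum exists. -/
def IsMixingTime {Ω : Type} [Fintype Ω] (π : Ω → ℝ) (P : Matrix (Supp π) (Supp π) ℝ)
    (ε : ℝ) (t : ℕ) : Prop :=
  IsLeast {s : ℕ | distToStationarity π P s ≤ ε} t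

/-- `π_min`, the smallest positive probability of a state. -/
def piMin {Ω : Type} (π : Ω → ℝ) : ℝ :=
  ⨅ x : Supp π, π x.1

open Classical in
/-- The unnormalized hardcore weight: `lam ^ |I|` on the indicator of an independent set `I` of `G`,
and `0` on every other configuration. -/
def hardcoreWeight {n : ℕ} (G : SimpleGraph (Fin n)) (lam : ℝ) (x : Fin n → Fin 2) : ℝ :=
  if ∀ i j, G.Adj i j → ¬ (x i = 1 ∧ x j = 1) then
    lam ^ (Finset.univ.filter fun i => x i = 1).card
  else 0

/-- The hardcore model on `G` with fugacity `lam`. -/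
def hardcore {n : ℕ} (G : SimpleGraph (Fin n)) (lam : ℝ) (x : Fin n → Fin 2) : ℝ :=
  hardcoreWeight G lam x / ∑ y, hardcoreWeight G lam y

end Gibbs

end

/-! On the complete graph the independent sets are the empty set and the singletons, and updating
site `i` averages over the empty set and `{i}`. During a sweep the occupied vertex moves only a
geometric number of places in the scan order, with mean about one. Sweeps thus act like a random
walk with bounded-variance steps on a cycle of length `n + 1`, and need order `n ^ 2` steps to mix.
Glauber dynamics empties the set with probability at least `1 / (2n)` per step, so it mixes in
`O(n)` steps.

The lower bound uses a complex test function of modulus at most one: with `w = exp(2πi / (n + 1))`,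
it is `w⁻¹ ^ (k + 1)` at the singleton of the site in position `k` (counted from zero) and `1 / (2 -
w)` at the empty set. One sweep multiplies it by `w` up to an error `O(1 / n ^ 2)`
(`norm_act_starScan_sub_le`), and its mean is `O(1 / n ^ 2)` (`norm_mean_scanEigenfun_le`). Its
modulus at a singleton therefore stays visible for order `n ^ 2` sweeps
(`norm_le_of_approx_eigenfunction`). The upper bound for Glauber is a Doeblin argument
(`sum_abs_pow_sub_le`). The tightness statement follows by inserting this example into the assumed
bound and cancelling the Glauber mixing time. -/

noncomputable section

namespace Gibbs

open Finset Matrix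

/-! ### Finite chains: Doeblin contraction and approximate eigenfunctions -/

section FiniteChains

variable {S : Type*} [Fintype S]

/-- A matrix that averages functions: nonnegative entries, rows of sum one. -/
def IsStochastic (P : Matrix S S ℝ) : Prop :=
  (∀ x y, 0 ≤ P x y) ∧ ∀ x, ∑ y, P x y = 1

lemma IsStochastic.mul {P Q : Matrix S S ℝ} (hP : IsStochastic P) (hQ : IsStochastic Q) :
    IsStochastic (P * Q) := by
  refine ⟨fun x y => ?_, fun x => ?_⟩
  · rw [Matrix.mul_apply]
    exact sum_nonneg fun z _ => mul_nonneg (hP.1 x z) (hQ.1 z y)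
  · simp only [Matrix.mul_apply]
    rw [sum_comm]
    simp only [← mul_sum, hQ.2, mul_one, hP.2]

/-- The action of a kernel on complex functions on its state space. -/
def act (P : Matrix S S ℝ) (f : S → ℂ) (x : S) : ℂ := ∑ y, (P x y : ℂ) * f y

lemma act_mul (P Q : Matrix S S ℝ) (f : S → ℂ) : act (P * Q) f = act P (act Q f) := by
  ext x
  simp only [act, Matrix.mul_apply, Complex.ofReal_sum, Complex.ofReal_mul, sum_mul, mul_sum]
  rw [sum_comm]
  simp only [mul_assoc]

lemma IsStochastic.norm_act_le {P : Matrix S S ℝ} (hP : IsStochastic P) {f : S → ℂ} {C : ℝ}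
    (hf : ∀ y, ‖f y‖ ≤ C) (x : S) : ‖act P f x‖ ≤ C := by
  calc ‖act P f x‖ ≤ ∑ y, P x y * C := by
        refine (norm_sum_le _ _).trans (sum_le_sum fun y _ => ?_)
        rw [norm_mul, Complex.norm_real, Real.norm_of_nonneg (hP.1 x y)]
        exact mul_le_mul_of_nonneg_left (hf y) (hP.1 x y)
    _ = C := by rw [← sum_mul, hP.2, one_mul]

variable [DecidableEq S]

lemma IsStochastic.one : IsStochastic (1 : Matrix S S ℝ) := by
  refine ⟨fun x y => ?_, fun x => ?_⟩
  · rw [Matrix.one_apply]; split_ifs <;> norm_num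
  · simp [Matrix.one_apply]

lemma IsStochastic.pow {P : Matrix S S ℝ} (hP : IsStochastic P) (t : ℕ) :
    IsStochastic (P ^ t) := by
  induction t with
  | zero => simpa using IsStochastic.one
  | succ t ih => rw [pow_succ]; exact ih.mul hP

/-- A Doeblin minorization contracts the `ℓ¹` norm of vectors of total mass zero. -/
lemma sum_abs_vecMul_le {P : Matrix S S ℝ} (hP : IsStochastic P) {z : S} {δ : ℝ}
    (hδ : ∀ x, δ ≤ P x z) (v : S → ℝ) (hv : ∑ x, v x = 0) :
    ∑ y, |(v ᵥ* P) y| ≤ (1 - δ) * ∑ x, |v x| := by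
  -- As `v` has mass zero, subtracting `δ` from all of column `z` does not change `v ᵥ* P`. What
  -- remains is nonnegative with row sums `1 - δ`.
  have key : ∀ y, (v ᵥ* P) y = ∑ x, v x * (P x y - if y = z then δ else 0) := by
    intro y
    simp only [mul_sub, sum_sub_distrib, ← sum_mul, hv, zero_mul, sub_zero]
    rfl
  have hn : ∀ x y, 0 ≤ P x y - if y = z then δ else 0 := by
    intro x y
    split_ifs with h
    · subst h; linarith [hδ x]
    · simpa using hP.1 x y
  calc ∑ y, |(v ᵥ* P) y| ≤ ∑ y, ∑ x, |v x| * (P x y - if y = z then δ else 0) := by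
        refine sum_le_sum fun y _ => ?_
        rw [key]
        refine (abs_sum_le_sum_abs _ _).trans (sum_le_sum fun x _ => ?_)
        rw [abs_mul, abs_of_nonneg (hn x y)]
    _ = (1 - δ) * ∑ x, |v x| := by
        rw [sum_comm, mul_sum]
        refine sum_congr rfl fun x _ => ?_
        rw [← mul_sum, sum_sub_distrib, hP.2, sum_ite_eq' univ z]
        simp [mul_comm]

/-- The point mass at `x` minus `μ` has mass zero and `ℓ¹` norm at most 2, and each step contracts
it by `1 - δ`. -/
lemma sum_abs_pow_sub_le {P : Matrix S S ℝ} (hP : IsStochastic P) {μ : S → ℝ}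
    (hμ0 : ∀ x, 0 ≤ μ x) (hμ1 : ∑ x, μ x = 1) (hμP : μ ᵥ* P = μ) {z : S} {δ : ℝ}
    (hδ : ∀ x, δ ≤ P x z) (hδ1 : δ ≤ 1) (t : ℕ) (x : S) :
    ∑ y, |(P ^ t) x y - μ y| ≤ 2 * (1 - δ) ^ t := by
  induction t with
  | zero =>
    calc ∑ y, |(P ^ 0) x y - μ y| ≤ ∑ y, ((1 : Matrix S S ℝ) x y + μ y) := by
          refine sum_le_sum fun y _ => ?_
          rw [pow_zero]
          refine (abs_sub _ _).trans ?_
          rw [abs_of_nonneg (IsStochastic.one.1 x y), abs_of_nonneg (hμ0 y)]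
      _ = 2 * (1 - δ) ^ 0 := by
          rw [sum_add_distrib, IsStochastic.one.2, hμ1]; norm_num
  | succ t ih =>
    have h : ∀ y, (P ^ (t + 1)) x y - μ y = ((fun y => (P ^ t) x y - μ y) ᵥ* P) y := by
      intro y
      have h1 : (fun y => (P ^ t) x y - μ y) = (P ^ t) x - μ := rfl
      rw [h1, Matrix.sub_vecMul, hμP, pow_succ]
      rfl
    simp only [h]
    refine (sum_abs_vecMul_le hP hδ _ ?_).trans ?_
    · rw [sum_sub_distrib, (hP.pow t).2, hμ1, sub_self]
    · rw [pow_succ]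
      nlinarith [sub_nonneg.2 hδ1]

lemma act_one (f : S → ℂ) : act 1 f = f := by
  ext x
  simp [act, Matrix.one_apply, apply_ite Complex.ofReal]

/-- Powers of a stochastic matrix on an approximate eigenfunction. -/
lemma norm_act_pow_sub_le {P : Matrix S S ℝ} (hP : IsStochastic P) {f : S → ℂ} {w : ℂ} {ε : ℝ}
    (hw : ‖w‖ = 1) (hf : ∀ x, ‖act P f x - w * f x‖ ≤ ε) (t : ℕ) (x : S) :
    ‖act (P ^ t) f x - w ^ t * f x‖ ≤ t * ε := by
  induction t generalizing x with
  | zero => simp [act_one]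
  | succ t ih =>
    have h1 := (hP.pow t).norm_act_le hf x
    have h2 : act (P ^ t) (fun x => act P f x - w * f x) x =
        act (P ^ t) (act P f) x - w * act (P ^ t) f x := by
      simp only [act, mul_sub, sum_sub_distrib, mul_sum]
      congr 1
      exact sum_congr rfl fun y _ => by ring
    -- Telescoping: each step adds an error of at most `ε`, since `P ^ t` does not increase the sup
    -- norm and `w` has modulus one.
    have h3 : act (P ^ (t + 1)) f x - w ^ (t + 1) * f x =
        act (P ^ t) (fun x => act P f x - w * f x) x
          + w * (act (P ^ t) f x - w ^ t * f x) := by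
      rw [h2, pow_succ, act_mul]; ring
    rw [h3]
    refine (norm_add_le _ _).trans ?_
    rw [norm_mul, hw, one_mul]
    push_cast
    linarith [ih x]

/-- `P ^ t f` stays near `w ^ t f`, which has the modulus of `f`, whereas mixing pushes it towards
the mean of `f`. When the mean is small, mixing forces `t * ε` to be of order one. -/
lemma norm_le_of_approx_eigenfunction {P : Matrix S S ℝ} (hP : IsStochastic P) {μ : S → ℝ}
    {f : S → ℂ} {w : ℂ} {ε : ℝ} (hw : ‖w‖ = 1) (hf : ∀ x, ‖act P f x - w * f x‖ ≤ ε)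
    (hf1 : ∀ x, ‖f x‖ ≤ 1) (t : ℕ) (x : S) :
    ‖f x‖ ≤ t * ε + ‖∑ y, (μ y : ℂ) * f y‖ + ∑ y, |(P ^ t) x y - μ y| := by
  have h1 := norm_act_pow_sub_le hP hw hf t x
  have h2 : ‖act (P ^ t) f x - ∑ y, (μ y : ℂ) * f y‖ ≤ ∑ y, |(P ^ t) x y - μ y| := by
    rw [act, ← sum_sub_distrib]
    refine (norm_sum_le _ _).trans (sum_le_sum fun y _ => ?_)
    rw [← sub_mul, norm_mul, ← Complex.ofReal_sub, Complex.norm_real, Real.norm_eq_abs]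
    exact mul_le_of_le_one_right (abs_nonneg _) (hf1 y)
  have h3 : ‖w ^ t * f x‖ = ‖f x‖ := by rw [norm_mul, norm_pow, hw, one_pow, one_mul]
  have h4 : w ^ t * f x = (act (P ^ t) f x - ∑ y, (μ y : ℂ) * f y)
      + (∑ y, (μ y : ℂ) * f y) - (act (P ^ t) f x - w ^ t * f x) := by ring
  rw [← h3, h4]
  refine (norm_sub_le _ _).trans ?_
  linarith [norm_add_le (act (P ^ t) f x - ∑ y, (μ y : ℂ) * f y) (∑ y, (μ y : ℂ) * f y)]

end FiniteChains

/-! ### The star chain: stationarity and minorizations -/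

section StarChain

variable {n : ℕ}

/-- The site kernel of the hardcore model on the complete graph: `none` is the empty set, `some i`
the singleton of `i`; it averages over `none` and `some i`. -/
def starKernel (i : Fin n) : Matrix (Option (Fin n)) (Option (Fin n)) ℝ :=
  Matrix.of fun x y =>
    if x = none ∨ x = some i then (if y = none ∨ y = some i then 1 / 2 else 0)
    else if x = y then 1 else 0

lemma starKernel_symm (i : Fin n) (x y : Option (Fin n)) :
    starKernel i x y = starKernel i y x := by
  simp only [starKernel, Matrix.of_apply]
  split_ifs <;> grind

lemma starKernel_isStochastic (i : Fin n) : IsStochastic (starKernel i) := by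
  refine ⟨fun x y => ?_, fun x => ?_⟩
  · simp only [starKernel, Matrix.of_apply]
    split_ifs <;> norm_num
  · simp only [starKernel, Matrix.of_apply]
    split_ifs with h
    · rw [Fintype.sum_option]
      simp
      norm_num
    · simp

lemma const_vecMul_starKernel (i : Fin n) (a : ℝ) :
    (fun _ => a) ᵥ* starKernel i = fun _ => a := by
  ext y
  simp only [Matrix.vecMul, dotProduct, starKernel_symm i _ y]
  rw [← mul_sum, (starKernel_isStochastic i).2, mul_one]

lemma act_starKernel (i : Fin n) (f : Option (Fin n) → ℂ) (x : Option (Fin n)) :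
    act (starKernel i) f x =
      if x = none ∨ x = some i then (f none + f (some i)) / 2 else f x := by
  simp only [act, starKernel, Matrix.of_apply]
  split_ifs with h
  · rw [Fintype.sum_option]
    simp [apply_ite Complex.ofReal]
    ring
  · simp [apply_ite Complex.ofReal]

/-- Glauber dynamics of the star chain. -/
def starGlauber (n : ℕ) : Matrix (Option (Fin n)) (Option (Fin n)) ℝ :=
  (1 / (n : ℝ)) • ∑ i : Fin n, starKernel i

/-- Systematic scan of the star chain. -/
def starScan (σ : Equiv.Perm (Fin n)) : Matrix (Option (Fin n)) (Option (Fin n)) ℝ :=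
  ((List.ofFn fun i : Fin n => starKernel (σ i)).reverse).prod

lemma starGlauber_isStochastic (hn : 1 ≤ n) : IsStochastic (starGlauber n) := by
  have hn' : (n : ℝ) ≠ 0 := by positivity
  refine ⟨fun x y => ?_, fun x => ?_⟩
  · simp only [starGlauber, Matrix.smul_apply, Matrix.sum_apply, smul_eq_mul]
    exact mul_nonneg (by positivity) (sum_nonneg fun i _ => (starKernel_isStochastic i).1 x y)
  · simp only [starGlauber, Matrix.smul_apply, Matrix.sum_apply, smul_eq_mul]
    rw [← mul_sum, sum_comm]
    simp [(starKernel_isStochastic _).2, hn']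

lemma const_vecMul_starGlauber (hn : 1 ≤ n) (a : ℝ) :
    (fun _ => a) ᵥ* starGlauber n = fun _ => a := by
  have hn' : (n : ℝ) ≠ 0 := by positivity
  rw [starGlauber, Matrix.vecMul_smul, Matrix.vecMul_sum]
  simp only [const_vecMul_starKernel]
  ext y
  simp
  field_simp

/-- Some site has `x` in its averaging pair; it is chosen with probability `1 / n` and then gives
`none` with probability `1 / 2`. -/
lemma le_starGlauber_none (x : Option (Fin n)) (hn : 1 ≤ n) :
    1 / (2 * (n : ℝ)) ≤ starGlauber n x none := by
  have hn' : (0 : ℝ) < n := by positivity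
  obtain ⟨i, hi⟩ : ∃ i : Fin n, x = none ∨ x = some i := by
    cases x with
    | none => exact ⟨⟨0, hn⟩, Or.inl rfl⟩
    | some i => exact ⟨i, Or.inr rfl⟩
  have h1 : (1 / 2 : ℝ) ≤ ∑ i : Fin n, starKernel i x none := by
    refine le_trans (le_of_eq ?_)
      (single_le_sum (fun j _ => (starKernel_isStochastic j).1 x none) (mem_univ i))
    simp [starKernel, hi]
  simp only [starGlauber, Matrix.smul_apply, Matrix.sum_apply, smul_eq_mul]
  calc 1 / (2 * (n : ℝ)) = 1 / n * (1 / 2) := by field_simp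
    _ ≤ _ := mul_le_mul_of_nonneg_left h1 (by positivity)

lemma isStochastic_prod_starKernel (l : List (Fin n)) :
    IsStochastic (l.map starKernel).prod := by
  induction l with
  | nil => simpa using IsStochastic.one
  | cons i l ih => simpa using (starKernel_isStochastic i).mul ih

lemma const_vecMul_prod_starKernel (l : List (Fin n)) (a : ℝ) :
    (fun _ => a) ᵥ* (l.map starKernel).prod = fun _ => a := by
  induction l with
  | nil => simp
  | cons i l ih =>
    rw [List.map_cons, List.prod_cons, ← Matrix.vecMul_vecMul, const_vecMul_starKernel, ih]

/-- Follow one path: hold at the singleton until its site is updated, drop to `none`, and remain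
there. Every update has probability at least `1 / 2` along this path. -/
lemma le_prod_starKernel_none (l : List (Fin n)) (x : Option (Fin n))
    (hx : ∀ i, x = some i → i ∈ l) :
    (1 / 2 : ℝ) ^ l.length ≤ (l.map starKernel).prod x none := by
  induction l generalizing x with
  | nil =>
    cases x with
    | none => simp
    | some i => simpa using hx i rfl
  | cons i l ih =>
    rw [List.map_cons, List.prod_cons, Matrix.mul_apply, List.length_cons, pow_succ]
    have hnn : ∀ y ∈ univ, 0 ≤ starKernel i x y * (l.map starKernel).prod y none :=
      fun y _ => mul_nonneg ((starKernel_isStochastic i).1 x y)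
        ((isStochastic_prod_starKernel l).1 y none)
    by_cases h : x = none ∨ x = some i
    · refine le_trans ?_ (single_le_sum hnn (mem_univ none))
      have h1 : starKernel i x none = 1 / 2 := by simp [starKernel, h]
      rw [h1, mul_comm]
      exact mul_le_mul_of_nonneg_left (ih none (by simp)) (by norm_num)
    · refine le_trans ?_ (single_le_sum hnn (mem_univ x))
      have h1 : starKernel i x x = 1 := by simp [starKernel, h]
      rw [h1, one_mul]
      have h2 := ih x fun j hj => by
        have := hx j hj
        simp only [List.mem_cons] at this
        rcases this with rfl | h'
        · exact absurd (Or.inr hj) h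
        · exact h'
      have h3 : (0 : ℝ) ≤ (1 / 2 : ℝ) ^ l.length := by positivity
      linarith

lemma starScan_eq (σ : Equiv.Perm (Fin n)) :
    starScan σ = ((List.ofFn σ).reverse.map starKernel).prod := by
  rw [starScan, List.map_reverse, List.map_ofFn]
  rfl

lemma starScan_isStochastic (σ : Equiv.Perm (Fin n)) : IsStochastic (starScan σ) := by
  rw [starScan_eq]; exact isStochastic_prod_starKernel _

lemma const_vecMul_starScan (σ : Equiv.Perm (Fin n)) (a : ℝ) :
    (fun _ => a) ᵥ* starScan σ = fun _ => a := by
  rw [starScan_eq]; exact const_vecMul_prod_starKernel _ a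

/-- This exponentially small bound serves only to show that the scan mixing time is finite. -/
lemma le_starScan_none (σ : Equiv.Perm (Fin n)) (x : Option (Fin n)) :
    (1 / 2 : ℝ) ^ n ≤ starScan σ x none := by
  rw [starScan_eq]
  refine le_trans (le_of_eq ?_) (le_prod_starKernel_none _ x fun i _ => ?_)
  · simp
  · simpa using ⟨σ.symm i, σ.apply_symm_apply i⟩

end StarChain

/-! ### The quadratic lower bound for the scan -/

section ScanLowerBound

variable {n : ℕ}

/-- The function which a partial sweep makes out of the approximate eigenfunction. -/
def scanFun (σ : Equiv.Perm (Fin n)) (v : ℂ) (lam : ℂ) (m : ℕ) : Option (Fin n) → ℂ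
  | none => lam * v ^ m
  | some i => (if (σ.symm i : ℕ) < m then lam else 1) * v ^ ((σ.symm i : ℕ) + 1)

/-- The relation between `lam` and `v` says that the average of `lam * v ^ m` and `v ^ (m + 1)` is
`lam * v ^ (m + 1)`. So each update advances the value at `none` by a factor `v` and leaves a factor
`lam` at the updated site. In the reversed product the newest site is the leftmost factor and acts
last on functions, hence the induction on the last site. -/
lemma act_partial_scan (σ : Equiv.Perm (Fin n)) {v lam : ℂ} (h : lam + v = 2 * lam * v)
    (m : ℕ) (hm : m ≤ n) :
    act ((List.ofFn fun i : Fin m => starKernel (σ (i.castLE hm))).reverse).prod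
      (scanFun σ v lam 0) = scanFun σ v lam m := by
  induction m with
  | zero => simp [act_one]
  | succ m ih =>
    rw [List.ofFn_succ_last, List.reverse_append, List.prod_append]
    simp only [List.reverse_singleton, List.prod_singleton]
    rw [act_mul]
    have := ih (Nat.le_of_succ_le hm)
    simp only [Fin.castLE_castSucc]
    rw [this]
    ext x
    rw [act_starKernel]
    set k : Fin n := (Fin.last m).castLE hm with hk
    have hkm : (k : ℕ) = m := rfl
    have hav : (scanFun σ v lam m none + scanFun σ v lam m (some (σ k))) / 2
        = lam * v ^ (m + 1) := by
      simp only [scanFun, Equiv.symm_apply_apply, hkm, lt_irrefl, if_false]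
      rw [pow_succ]
      linear_combination (v ^ m / 2) * h
    rw [hav]
    cases x with
    | none => simp [scanFun]
    | some i =>
      by_cases hi : i = σ k
      · subst hi
        simp [scanFun, hkm]
      · have hne : (σ.symm i : ℕ) ≠ m := by
          intro h'
          apply hi
          rw [← σ.apply_symm_apply i]
          exact congrArg σ (Fin.ext (h'.trans hkm.symm))
        have hlt : (σ.symm i : ℕ) < m + 1 ↔ (σ.symm i : ℕ) < m := by omega
        simp [scanFun, hi, hlt]

/-- The one-step rotation of the scan: a primitive `(n + 1)`-st root of unity. -/
def rot (n : ℕ) : ℂ := Complex.exp (Complex.I * ((2 * Real.pi / ((n : ℝ) + 1) : ℝ) : ℂ))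

lemma rot_isPrimitiveRoot (n : ℕ) : IsPrimitiveRoot (rot n) (n + 1) := by
  have h := Complex.isPrimitiveRoot_exp (n + 1) (Nat.succ_ne_zero n)
  convert h using 1
  rw [rot]
  congr 1
  push_cast
  ring

lemma norm_rot (n : ℕ) : ‖rot n‖ = 1 := by
  rw [rot, mul_comm]; exact Complex.norm_exp_ofReal_mul_I _

lemma norm_rot_sub_one_le (n : ℕ) : ‖rot n - 1‖ ≤ 2 * Real.pi / ((n : ℝ) + 1) := by
  have h := Real.norm_exp_I_mul_ofReal_sub_one_le (x := 2 * Real.pi / ((n : ℝ) + 1))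
  rwa [Real.norm_of_nonneg (by positivity)] at h

lemma one_le_norm_two_sub_rot (n : ℕ) : 1 ≤ ‖2 - rot n‖ := by
  have h := norm_sub_norm_le (2 : ℂ) (rot n)
  rw [norm_rot, Complex.norm_two] at h
  linarith

lemma two_sub_rot_ne_zero (n : ℕ) : 2 - rot n ≠ 0 := by
  intro h
  have := one_le_norm_two_sub_rot n
  rw [h, norm_zero] at this
  linarith

lemma rot_ne_zero (n : ℕ) : rot n ≠ 0 := by
  rw [← norm_pos_iff, norm_rot]; norm_num

/-- An approximate eigenfunction of the systematic scan. -/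
def scanEigenfun (σ : Equiv.Perm (Fin n)) : Option (Fin n) → ℂ :=
  scanFun σ (rot n)⁻¹ (2 - rot n)⁻¹ 0

lemma act_starScan_scanEigenfun (σ : Equiv.Perm (Fin n)) :
    act (starScan σ) (scanEigenfun σ) = scanFun σ (rot n)⁻¹ (2 - rot n)⁻¹ n := by
  -- With `v = w⁻¹`, the relation `lam + v = 2 * lam * v` forces `lam = (2 - w)⁻¹`.
  refine act_partial_scan σ ?_ n le_rfl
  have h1 := two_sub_rot_ne_zero n
  have h2 := rot_ne_zero n
  field_simp
  ring

lemma norm_inv_two_sub_rot_le (n : ℕ) : ‖(2 - rot n)⁻¹‖ ≤ 1 := by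
  rw [norm_inv]
  exact inv_le_one_of_one_le₀ (one_le_norm_two_sub_rot n)

lemma norm_scanEigenfun_some (σ : Equiv.Perm (Fin n)) (i : Fin n) :
    ‖scanEigenfun σ (some i)‖ = 1 := by
  simp [scanEigenfun, scanFun, norm_rot]

lemma norm_scanEigenfun_le (σ : Equiv.Perm (Fin n)) (x : Option (Fin n)) :
    ‖scanEigenfun σ x‖ ≤ 1 := by
  cases x with
  | none => simpa [scanEigenfun, scanFun] using norm_inv_two_sub_rot_le n
  | some i => exact (norm_scanEigenfun_some σ i).le

/-- At `none` there is no error, because `w ^ (n + 1) = 1`. At a singleton the error has modulus `|1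
/ (2 - w) - w| = |w - 1| ^ 2 / |2 - w|`: it is of second order because `1 / (2 - w)` is tangent to
`w` at `w = 1`. -/
lemma norm_act_starScan_sub_le (σ : Equiv.Perm (Fin n)) (x : Option (Fin n)) :
    ‖act (starScan σ) (scanEigenfun σ) x - rot n * scanEigenfun σ x‖
      ≤ (2 * Real.pi / ((n : ℝ) + 1)) ^ 2 := by
  rw [act_starScan_scanEigenfun]
  have h1 := two_sub_rot_ne_zero n
  cases x with
  | none =>
    have h3 : (rot n)⁻¹ ^ n = rot n := by
      rw [inv_pow]
      refine inv_eq_of_mul_eq_one_right ?_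
      rw [← pow_succ]
      exact (rot_isPrimitiveRoot n).pow_eq_one
    simp only [scanEigenfun, scanFun, h3, pow_zero, mul_one]
    rw [mul_comm, sub_self, norm_zero]
    positivity
  | some i =>
    have h3 : scanFun σ (rot n)⁻¹ (2 - rot n)⁻¹ n (some i) - rot n * scanEigenfun σ (some i)
        = (rot n - 1) ^ 2 * (2 - rot n)⁻¹ * (rot n)⁻¹ ^ ((σ.symm i : ℕ) + 1) := by
      simp only [scanEigenfun, scanFun, Fin.is_lt, if_true, not_lt_zero, if_false]
      have h4 : (2 - rot n)⁻¹ - rot n = (rot n - 1) ^ 2 * (2 - rot n)⁻¹ := by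
        field_simp
        ring
      rw [← h4]
      ring
    rw [h3, norm_mul, norm_mul, norm_pow, norm_pow, norm_inv (rot n), norm_rot, inv_one, one_pow,
      mul_one]
    refine (mul_le_of_le_one_right (by positivity) (norm_inv_two_sub_rot_le n)).trans ?_
    exact pow_le_pow_left₀ (norm_nonneg _) (norm_rot_sub_one_le n) 2

/-- The powers of `w⁻¹` with exponents `1` to `n` sum to `-1`, which leaves `1 / (2 - w) - 1`. -/
lemma sum_scanEigenfun (σ : Equiv.Perm (Fin n)) (hn : 1 ≤ n) :
    ∑ x, scanEigenfun σ x = (rot n - 1) * (2 - rot n)⁻¹ := by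
  have h1 := two_sub_rot_ne_zero n
  have hg := (rot_isPrimitiveRoot n).inv.geom_sum_eq_zero (by omega)
  rw [sum_range_succ', pow_zero] at hg
  have h2 : ∑ i, scanEigenfun σ (some i) = ∑ k ∈ range n, (rot n)⁻¹ ^ (k + 1) := by
    rw [← Fin.sum_univ_eq_sum_range (fun k => (rot n)⁻¹ ^ (k + 1)) n,
      ← Equiv.sum_comp σ.symm fun k : Fin n => (rot n)⁻¹ ^ ((k : ℕ) + 1)]
    simp [scanEigenfun, scanFun]
  rw [Fintype.sum_option, h2, eq_neg_of_add_eq_zero_left hg]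
  simp only [scanEigenfun, scanFun, pow_zero, mul_one]
  field_simp
  ring

lemma norm_mean_scanEigenfun_le (σ : Equiv.Perm (Fin n)) (hn : 1 ≤ n) :
    ‖∑ x, ((1 / ((n : ℝ) + 1) : ℝ) : ℂ) * scanEigenfun σ x‖
      ≤ 2 * Real.pi / ((n : ℝ) + 1) ^ 2 := by
  rw [← mul_sum, sum_scanEigenfun σ hn, norm_mul, norm_mul, Complex.norm_real,
    Real.norm_of_nonneg (by positivity)]
  calc 1 / ((n : ℝ) + 1) * (‖rot n - 1‖ * ‖(2 - rot n)⁻¹‖)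
      ≤ 1 / ((n : ℝ) + 1) * (2 * Real.pi / ((n : ℝ) + 1) * 1) := by
        gcongr
        · exact norm_rot_sub_one_le n
        · exact norm_inv_two_sub_rot_le n
    _ = _ := by field_simp

lemma le_of_starScan_mixed (σ : Equiv.Perm (Fin n)) (hn : 5 ≤ n) (t : ℕ)
    (ht : ∀ x, ∑ y, |(starScan σ ^ t) x y - 1 / ((n : ℝ) + 1)| ≤ 1 / 2) :
    ((n : ℝ) + 1) ^ 2 / 160 ≤ t := by
  have h := norm_le_of_approx_eigenfunction (starScan_isStochastic σ)
    (μ := fun _ => 1 / ((n : ℝ) + 1)) (norm_rot n) (norm_act_starScan_sub_le σ)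
    (norm_scanEigenfun_le σ) t (some ⟨0, by omega⟩)
  rw [norm_scanEigenfun_some] at h
  have h1 := norm_mean_scanEigenfun_le σ (by omega)
  have h2 := ht (some ⟨0, by omega⟩)
  have hn' : (5 : ℝ) ≤ n := by exact_mod_cast hn
  have hpi := Real.pi_lt_d2
  have hpi0 := Real.pi_pos
  have hN : (36 : ℝ) ≤ ((n : ℝ) + 1) ^ 2 := by nlinarith
  have hN0 : (0 : ℝ) < ((n : ℝ) + 1) ^ 2 := by linarith
  -- This needs `(n + 1) ^ 2 ≥ 8π`, which holds exactly from `n = 5` on.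
  have h3 : 2 * Real.pi / ((n : ℝ) + 1) ^ 2 ≤ 1 / 4 := by
    rw [div_le_iff₀ hN0]; linarith
  -- Modulus one at a singleton, minus `1 / 4` for the mean and `1 / 2` for the distance, leaves `1
  -- / 4`. With `(2π) ^ 2 ≤ 40` this yields the constant `160`.
  have h4 : (1 / 4 : ℝ) ≤ t * (2 * Real.pi / ((n : ℝ) + 1)) ^ 2 := by
    have h5 : (1 : ℝ) ≤ t * (2 * Real.pi / ((n : ℝ) + 1)) ^ 2 + 1 / 4 + 1 / 2 := by
      refine h.trans (add_le_add (add_le_add le_rfl (h1.trans h3)) h2)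
    linarith
  rw [div_pow, ← mul_div_assoc, le_div_iff₀ hN0] at h4
  have h6 : (2 * Real.pi) ^ 2 ≤ 40 := by nlinarith
  have h7 : (t : ℝ) * (2 * Real.pi) ^ 2 ≤ t * 40 := by gcongr
  linarith

end ScanLowerBound

end Gibbs

end

noncomputable section

namespace Gibbs

open Finset Matrix

/-! ### Identifying the hardcore model on the complete graph with the star chain -/

section Hardcore

variable {n : ℕ}

/-- The independent sets of the complete graph. -/
def conf : Option (Fin n) → (Fin n → Fin 2)
  | none => 0
  | some i => Pi.single i 1

lemma conf_eq_one_iff (s : Option (Fin n)) (j : Fin n) : conf s j = 1 ↔ s = some j := by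
  cases s with
  | none => simp [conf]
  | some i =>
    by_cases h : j = i
    · subst h; simp [conf]
    · simp [conf, h, Ne.symm h]

lemma conf_injective : Function.Injective (conf (n := n)) := by
  intro s t h
  have h' : ∀ j, s = some j ↔ t = some j := fun j => by
    rw [← conf_eq_one_iff, ← conf_eq_one_iff, h]
  cases s with
  | some i => exact ((h' i).1 rfl).symm
  | none =>
    cases t with
    | none => rfl
    | some i => exact (h' i).2 rfl

lemma mem_range_conf_iff (x : Fin n → Fin 2) :
    x ∈ Set.range (conf (n := n)) ↔ ∀ i j, i ≠ j → ¬ (x i = 1 ∧ x j = 1) := by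
  constructor
  · rintro ⟨s, rfl⟩ i j hij ⟨hi, hj⟩
    rw [conf_eq_one_iff] at hi hj
    exact hij (Option.some_injective _ (hi.symm.trans hj))
  · intro h
    have ext1 : ∀ s : Option (Fin n), (∀ j, conf s j = 1 ↔ x j = 1) → conf s = x := by
      intro s hs
      ext j
      have := hs j
      omega
    by_cases hx : ∃ i, x i = 1
    · obtain ⟨i, hi⟩ := hx
      refine ⟨some i, ext1 _ fun j => ?_⟩
      rw [conf_eq_one_iff, Option.some_inj]
      constructor
      · rintro rfl; exact hi
      · intro hj
        by_contra hij
        exact h i j hij ⟨hi, hj⟩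
    · refine ⟨none, ext1 _ fun j => ?_⟩
      rw [conf_eq_one_iff]
      simpa using fun hj => hx ⟨j, hj⟩

open Classical in
lemma hardcoreWeight_top (x : Fin n → Fin 2) :
    hardcoreWeight (⊤ : SimpleGraph (Fin n)) 1 x =
      if x ∈ Set.range (conf (n := n)) then 1 else 0 := by
  simp only [hardcoreWeight, SimpleGraph.top_adj, one_pow, mem_range_conf_iff]

lemma sum_hardcoreWeight_top :
    ∑ y : Fin n → Fin 2, hardcoreWeight (⊤ : SimpleGraph (Fin n)) 1 y = (n : ℝ) + 1 := by
  classical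
  simp only [hardcoreWeight_top, sum_boole]
  have h : (univ.filter fun x => x ∈ Set.range (conf (n := n))) = univ.image conf := by
    ext x; simp
  rw [h, card_image_of_injective _ conf_injective]
  simp

/-- The hardcore model on the complete graph at fugacity one. -/
abbrev starDist (n : ℕ) : (Fin n → Fin 2) → ℝ := hardcore (⊤ : SimpleGraph (Fin n)) 1

open Classical in
lemma starDist_apply (x : Fin n → Fin 2) :
    starDist n x = if x ∈ Set.range (conf (n := n)) then 1 / ((n : ℝ) + 1) else 0 := by
  rw [starDist, hardcore, sum_hardcoreWeight_top, hardcoreWeight_top]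
  split_ifs <;> simp

lemma starDist_conf (s : Option (Fin n)) : starDist n (conf s) = 1 / ((n : ℝ) + 1) := by
  rw [starDist_apply, if_pos ⟨s, rfl⟩]

lemma starDist_ne_zero_iff (x : Fin n → Fin 2) :
    starDist n x ≠ 0 ↔ x ∈ Set.range (conf (n := n)) := by
  rw [starDist_apply]
  have : (n : ℝ) + 1 ≠ 0 := by positivity
  split_ifs with h <;> simp [h, this]

lemma starDist_mem_stdSimplex (n : ℕ) : starDist n ∈ stdSimplex ℝ (Fin n → Fin 2) := by
  refine ⟨fun x => ?_, ?_⟩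
  · rw [starDist_apply]
    split_ifs
    · positivity
    · exact le_rfl
  · simp only [starDist, hardcore]
    rw [← sum_div, div_self]
    rw [sum_hardcoreWeight_top]
    positivity

/-- The support of the hardcore model on the complete graph. -/
def confEquiv (n : ℕ) : Option (Fin n) ≃ Supp (starDist n) :=
  Equiv.ofBijective
    (fun s => ⟨conf s, (starDist_ne_zero_iff _).2 ⟨s, rfl⟩⟩)
    ⟨fun _ _ h => conf_injective (congrArg Subtype.val h), fun ⟨x, hx⟩ => by
      obtain ⟨s, rfl⟩ := (starDist_ne_zero_iff x).1 hx
      exact ⟨s, rfl⟩⟩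

lemma confEquiv_val (s : Option (Fin n)) : (confEquiv n s).1 = conf s := rfl

lemma piMin_starDist (n : ℕ) : piMin (starDist n) = 1 / ((n : ℝ) + 1) := by
  rw [piMin, ← (confEquiv n).iInf_comp]
  simp only [confEquiv_val, starDist_conf, ciInf_const]

lemma update_conf_zero (s : Option (Fin n)) (i : Fin n) :
    Function.update (conf s) i 0 = conf (if s = some i then none else s) := by
  ext j
  have h1 := conf_eq_one_iff s j
  have h2 := conf_eq_one_iff (if s = some i then none else s) j
  by_cases hj : j = i
  · subst hj
    rw [Function.update_self]
    split_ifs at h2 ⊢ with h <;> grind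
  · rw [Function.update_of_ne hj]
    split_ifs at h2 ⊢ with h <;> grind

lemma sum_starDist_update (s : Option (Fin n)) (i : Fin n) :
    ∑ z : Fin 2, starDist n (Function.update (conf s) i z)
      = (if s = none ∨ s = some i then 2 else 1) * (1 / ((n : ℝ) + 1)) := by
  rw [Fin.sum_univ_two, update_conf_zero, starDist_conf]
  split_ifs with h
  · have : Function.update (conf s) i 1 = conf (some i) := by
      rcases h with rfl | rfl
      · rfl
      · ext j
        by_cases hj : j = i
        · subst hj; simp [conf]
        · simp [conf, hj]
    rw [this, starDist_conf]
    ring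
  · have : Function.update (conf s) i 1 ∉ Set.range (conf (n := n)) := by
      rw [mem_range_conf_iff]
      push Not at h ⊢
      obtain ⟨j, rfl⟩ := Option.ne_none_iff_exists'.1 h.1
      have hji : j ≠ i := fun hh => h.2 (by rw [hh])
      refine ⟨j, i, hji, ?_, by simp⟩
      rw [Function.update_of_ne hji, conf_eq_one_iff]
    rw [starDist_apply, if_neg this]
    ring

lemma conf_agree_iff (s t : Option (Fin n)) (i : Fin n) :
    (∀ j, j ≠ i → conf t j = conf s j) ↔
      s = t ∨ ((s = none ∨ s = some i) ∧ (t = none ∨ t = some i)) := by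
  have key : ∀ s t : Option (Fin n), ∀ j, (conf t j = conf s j) ↔ (t = some j ↔ s = some j) := by
    intro s t j
    rw [← conf_eq_one_iff, ← conf_eq_one_iff]
    omega
  simp only [key]
  constructor
  · intro h
    cases s <;> cases t <;> grind
  · rintro (rfl | ⟨h1, h2⟩) j hj <;> grind

/-- If another vertex is occupied, site `i` must stay empty and the update does nothing; otherwise
both values have equal weight. -/
lemma siteKernel_starDist (i : Fin n) :
    (siteKernel (starDist n) i).submatrix (confEquiv n) (confEquiv n) = starKernel i := by
  have hn : (n : ℝ) + 1 ≠ 0 := by positivity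
  ext s t
  simp only [siteKernel, Matrix.submatrix_apply, Matrix.of_apply, confEquiv_val, starKernel,
    conf_agree_iff, starDist_conf, sum_starDist_update]
  by_cases hs : s = none ∨ s = some i
  · by_cases ht : t = none ∨ t = some i
    · rw [if_pos (Or.inr ⟨hs, ht⟩), if_pos hs, if_pos hs, if_pos ht]
      field_simp
    · rw [if_neg, if_pos hs, if_neg ht]
      rintro (rfl | h)
      · exact ht hs
      · exact ht h.2
  · by_cases hst : s = t
    · rw [if_pos (Or.inl hst), if_neg hs, if_neg hs, if_pos hst]
      field_simp
    · rw [if_neg, if_neg hs, if_neg hst]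
      rintro (rfl | h)
      · exact hst rfl
      · exact hs h.1

lemma glauber_starDist (n : ℕ) :
    (glauber (starDist n)).submatrix (confEquiv n) (confEquiv n) = starGlauber n := by
  rw [glauber, starGlauber]
  ext s t
  simp only [Matrix.submatrix_apply, Matrix.smul_apply, Matrix.sum_apply, ← siteKernel_starDist]

lemma systematicScan_starDist (σ : Equiv.Perm (Fin n)) :
    (systematicScan (starDist n) σ).submatrix (confEquiv n) (confEquiv n) = starScan σ := by
  classical
  let φ := Matrix.reindexAlgEquiv ℝ ℝ (confEquiv n).symm
  have h : ∀ M, M.submatrix (confEquiv n) (confEquiv n) = φ M := fun M => rfl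
  have h' : ∀ i, φ (siteKernel (starDist n) i) = starKernel i := siteKernel_starDist
  rw [h, starScan]
  -- The definition takes matrix products with classical decidable equality; the two instances agree
  -- by uniqueness.
  have hscan : systematicScan (starDist n) σ
      = (List.ofFn fun i => siteKernel (starDist n) (σ i)).reverse.prod := by
    unfold systematicScan
    congr!
  rw [hscan]
  refine (map_list_prod φ (List.ofFn fun i => siteKernel (starDist n) (σ i)).reverse).trans ?_
  rw [List.map_reverse, List.map_ofFn]
  congr 3
  ext1 i
  exact h' (σ i)

lemma distToStationarity_starDist_le_iff
    {P : Matrix (Supp (starDist n)) (Supp (starDist n)) ℝ}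
    {Q : Matrix (Option (Fin n)) (Option (Fin n)) ℝ}
    (h : P.submatrix (confEquiv n) (confEquiv n) = Q) (t : ℕ) :
    distToStationarity (starDist n) P t ≤ 1 / 4 ↔
      ∀ x, ∑ y, |(Q ^ t) x y - 1 / ((n : ℝ) + 1)| ≤ 1 / 2 := by
  classical
  subst h
  have hpow : (P.submatrix (confEquiv n) (confEquiv n)) ^ t
      = (P ^ t).submatrix (confEquiv n) (confEquiv n) :=
    (map_pow (Matrix.reindexAlgEquiv ℝ ℝ (confEquiv n).symm) P t).symm
  have : Nonempty (Supp (starDist n)) := ⟨confEquiv n none⟩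
  rw [distToStationarity, ciSup_le_iff (Set.finite_range _).bddAbove,
    ← (confEquiv n).forall_congr_right]
  refine forall_congr' fun x => ?_
  rw [hpow]
  simp only [tvDist, Matrix.submatrix_apply]
  rw [← (confEquiv n).sum_comp]
  simp only [confEquiv_val, starDist_conf]
  have key : (1 / 2 : ℝ) * ∑ y, |(P ^ t) (confEquiv n x) (confEquiv n y) - 1 / ((n : ℝ) + 1)| ≤ 1 / 4
      ↔ ∑ y, |(P ^ t) (confEquiv n x) (confEquiv n y) - 1 / ((n : ℝ) + 1)| ≤ 1 / 2 :=
    ⟨fun h => by linarith, fun h => by linarith⟩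
  convert key
  rfl

/-! ### Existence and comparison of the mixing times -/

lemma exists_isMixingTime {Ω : Type} [Fintype Ω] {π : Ω → ℝ} {P : Matrix (Supp π) (Supp π) ℝ}
    {ε : ℝ} {s : ℕ} (hs : distToStationarity π P s ≤ ε) : ∃ t, IsMixingTime π P ε t ∧ t ≤ s :=
  ⟨sInf {s | distToStationarity π P s ≤ ε},
    ⟨Nat.sInf_mem ⟨s, hs⟩, fun _ h => Nat.sInf_le h⟩, Nat.sInf_le hs⟩

/-- The point mass at the empty set has `ℓ¹` distance `2n / (n + 1) ≥ 1` from uniform. Positivity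
handles small `n` and allows division by the Glauber mixing time. -/
lemma one_le_of_isMixingTime (hn : 1 ≤ n)
    {P : Matrix (Supp (starDist n)) (Supp (starDist n)) ℝ} {t : ℕ}
    (ht : IsMixingTime (starDist n) P (1 / 4) t) : 1 ≤ t := by
  by_contra h
  obtain rfl : t = 0 := by omega
  have h0 := (distToStationarity_starDist_le_iff rfl 0).1 ht.1 none
  have hn' : (1 : ℝ) ≤ n := by exact_mod_cast hn
  have hnn : (n : ℝ) + 1 ≠ 0 := by positivity
  rw [Fintype.sum_option] at h0
  simp only [pow_zero, Matrix.one_apply, if_true, reduceCtorEq, if_false, zero_sub, abs_neg,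
    sum_const, card_univ, Fintype.card_fin, nsmul_eq_mul] at h0
  have h1 : (1 : ℝ) - 1 / ((n : ℝ) + 1) = n / (n + 1) := by field_simp; ring
  have h2 : (n : ℝ) * (1 / ((n : ℝ) + 1)) = n / (n + 1) := by ring
  have h3 : (1 : ℝ) / 2 ≤ n / (n + 1) := by
    rw [div_le_div_iff₀ (by norm_num) (by positivity)]; linarith
  rw [h1, abs_of_nonneg (by positivity), abs_of_nonneg (by positivity), h2] at h0
  linarith

lemma sum_uniform (n : ℕ) : ∑ _x : Option (Fin n), 1 / ((n : ℝ) + 1) = 1 := by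
  have hn : (n : ℝ) + 1 ≠ 0 := by positivity
  simp
  field_simp

lemma exists_glauber_mixingTime (hn : 1 ≤ n) :
    ∃ t, IsMixingTime (starDist n) (glauber (starDist n)) (1 / 4) t ∧ t ≤ 4 * n := by
  refine exists_isMixingTime ((distToStationarity_starDist_le_iff (glauber_starDist n) _).2
    fun x => ?_)
  have hn' : (1 : ℝ) ≤ n := by exact_mod_cast hn
  have hδ : 1 / (2 * (n : ℝ)) ≤ 1 := by rw [div_le_one (by positivity)]; linarith
  refine (sum_abs_pow_sub_le (starGlauber_isStochastic hn) (fun _ => by positivity)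
    (sum_uniform n) (const_vecMul_starGlauber hn _) (fun x => le_starGlauber_none x hn)
    hδ (4 * n) x).trans ?_
  have h1 : 1 - 1 / (2 * (n : ℝ)) ≤ Real.exp (-(1 / (2 * (n : ℝ)))) := Real.one_sub_le_exp_neg _
  -- The choice of `4 * n` steps makes the exponent `-2`, and `2 * exp (-2) ≤ 1 / 2` is what the
  -- `ℓ¹` bound requires.
  have h2 : (1 - 1 / (2 * (n : ℝ))) ^ (4 * n) ≤ Real.exp (-2) := by
    refine (pow_le_pow_left₀ (by linarith) h1 _).trans (le_of_eq ?_)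
    rw [← Real.exp_nat_mul]
    congr 1
    push_cast
    field_simp
    norm_num
  have h3 : Real.exp (-2) ≤ 1 / 4 := by
    have h4 : (2 : ℝ) ≤ Real.exp 1 := by linarith [Real.add_one_le_exp (1 : ℝ)]
    rw [Real.exp_neg, show (2 : ℝ) = 1 + 1 by norm_num, Real.exp_add, one_div]
    exact inv_anti₀ (by norm_num) (by nlinarith)
  linarith

lemma exists_scan_mixingTime (σ : Equiv.Perm (Fin n)) :
    ∃ t, IsMixingTime (starDist n) (systematicScan (starDist n) σ) (1 / 4) t := by
  have hδ0 : (0 : ℝ) < (1 / 2 : ℝ) ^ n := by positivity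
  have hδ1 : (1 / 2 : ℝ) ^ n ≤ 1 := pow_le_one₀ (by norm_num) (by norm_num)
  obtain ⟨s, hs⟩ := exists_pow_lt_of_lt_one (show (0 : ℝ) < 1 / 4 by norm_num)
    (show 1 - (1 / 2 : ℝ) ^ n < 1 by linarith)
  obtain ⟨t, ht, -⟩ := exists_isMixingTime (s := s)
    ((distToStationarity_starDist_le_iff (systematicScan_starDist σ) _).2 fun x =>
      (sum_abs_pow_sub_le (starScan_isStochastic σ) (fun _ => by positivity)
        (sum_uniform n) (const_vecMul_starScan σ _) (le_starScan_none σ) hδ1 s x).trans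
        (by linarith))
  exact ⟨t, ht⟩

lemma glauber_le_scan_mixingTime (hn : 1 ≤ n) (σ : Equiv.Perm (Fin n)) {tGD tSS : ℕ}
    (hGD : tGD ≤ 4 * n)
    (hSS : IsMixingTime (starDist n) (systematicScan (starDist n) σ) (1 / 4) tSS) :
    1 / 1000 * (n : ℝ) * (tGD : ℝ) ≤ tSS := by
  have h1 : (1 : ℝ) ≤ tSS := by exact_mod_cast one_le_of_isMixingTime hn hSS
  have h2 : (tGD : ℝ) ≤ 4 * n := by exact_mod_cast hGD
  have h0 : (0 : ℝ) ≤ n := by positivity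
  have h3 : (n : ℝ) * tGD ≤ n * (4 * n) := mul_le_mul_of_nonneg_left h2 h0
  -- For `n ≥ 5` it suffices that `4 / 1000 ≤ 1 / 160`; for `n ≤ 4` the left side is at most `64 /
  -- 1000`, below `1 ≤ tSS`.
  by_cases h5 : 5 ≤ n
  · have h4 := le_of_starScan_mixed σ h5 tSS
      ((distToStationarity_starDist_le_iff (systematicScan_starDist σ) _).1 hSS.1)
    nlinarith
  · have h6 : (n : ℝ) ≤ 4 := by exact_mod_cast (by omega : n ≤ 4)
    nlinarith

end Hardcore

end Gibbs

end

theorem mainTheorem9 :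
    ∃ c : ℝ, 0 < c ∧
      -- the mixing time comparison for the hardcore model on `K_n` with fugacity `1`
      (∀ n : ℕ, 1 ≤ n → ∀ σ : Equiv.Perm (Fin n),
        ∃ tGD tSS : ℕ,
          Gibbs.IsMixingTime (Gibbs.hardcore (⊤ : SimpleGraph (Fin n)) 1)
            (Gibbs.glauber (Gibbs.hardcore (⊤ : SimpleGraph (Fin n)) 1)) (1 / 4) tGD ∧
          Gibbs.IsMixingTime (Gibbs.hardcore (⊤ : SimpleGraph (Fin n)) 1)
            (Gibbs.systematicScan (Gibbs.hardcore (⊤ : SimpleGraph (Fin n)) 1) σ) (1 / 4) tSS ∧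
          c * (n : ℝ) * (tGD : ℝ) ≤ (tSS : ℝ)) ∧
      -- tightness: a factor `Φ(π_min)` in a bound for all distributions and all scan orders
      -- is at least `c * n`
      (∀ n : ℕ, 1 ≤ n → ∀ Φ : ℝ → ℝ,
        (∀ (X : Fin n → Type) [∀ i, Fintype (X i)] (π : (∀ i, X i) → ℝ),
          π ∈ stdSimplex ℝ (∀ i, X i) →
          ∀ (σ : Equiv.Perm (Fin n)) (tGD tSS : ℕ),
            Gibbs.IsMixingTime π (Gibbs.glauber π) (1 / 4) tGD →
            Gibbs.IsMixingTime π (Gibbs.systematicScan π σ) (1 / 4) tSS →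
            (tSS : ℝ) ≤ Φ (Gibbs.piMin π) * (tGD : ℝ)) →
        c * (n : ℝ) ≤ Φ (1 / ((n : ℝ) + 1))) := by
  refine ⟨1 / 1000, by norm_num, fun n hn σ => ?_, fun n hn Φ hΦ => ?_⟩
  · obtain ⟨tGD, hGD, hle⟩ := Gibbs.exists_glauber_mixingTime hn
    obtain ⟨tSS, hSS⟩ := Gibbs.exists_scan_mixingTime σ
    exact ⟨tGD, tSS, hGD, hSS, Gibbs.glauber_le_scan_mixingTime hn σ hle hSS⟩
  · obtain ⟨tGD, hGD, hle⟩ := Gibbs.exists_glauber_mixingTime hn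
    -- Any scan order would serve here; the identity is taken.
    obtain ⟨tSS, hSS⟩ := Gibbs.exists_scan_mixingTime (1 : Equiv.Perm (Fin n))
    have h := hΦ (fun _ => Fin 2) (Gibbs.starDist n) (Gibbs.starDist_mem_stdSimplex n) 1 tGD tSS
      hGD hSS
    rw [Gibbs.piMin_starDist] at h
    have h0 : (0 : ℝ) < tGD := by exact_mod_cast Gibbs.one_le_of_isMixingTime hn hGD
    exact le_of_mul_le_mul_right ((Gibbs.glauber_le_scan_mixingTime hn 1 hle hSS).trans h) h0
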